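/- Let $E$ be a real Banach space, let $T\colon\ell^1\to E$ be a continuous linear operator on the space of absolutely summable real sequences, let $e_n=\chi_{\{n\}}$ be the unit vectors, and assume $T(e_n)\neq 0$ for all $n\in\mathbb{N}$. Let $1<p<\infty$. Let $m_T\colon\mathcal{P}_F(\mathbb{N})\to E$, $m_T(A)=T(\chi_A)$, be the associated vector measure on the $\delta$-ring $\mathcal{P}_F(\mathbb{N})$ of finite subsets of $\mathbb{N}$. For $x^*\in E^*$ let $|x^*m_T|$ be the variation of the real measure $x^*m_T$, that is, $|x^*m_T|(A)=\sup\sum_j|x^*m_T(A_j)|$, where the supremum is over all finite disjoint families of finite sets $A_j\subset A$. For $f\in L^1(|x^*m_T|)$ and $A\subset\mathbb{N}$ put $\int_A f\,dx^*m_T=\lim_n\int_A\varphi_n\,dx^*m_T$, where $(\varphi_n)$ is any sequence of finitely supported functions converging to $f$ in $L^1(|x^*m_T|)$ and $\int_A\varphi\,dx^*m_T=\sum_j\alpha_j\,x^*m_T(A_j\cap A)$ for $\varphi=\sum_j\alpha_j\chi_{A_j}$ (a finite sum with $A_j$ finite). Let $\ell^1(m_T)$ be the space of all real sequences $f$ such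 that (i) $f\in L^1(|x^*m_T|)$ for every $x^*\in E^*$, and (ii) for every $A\subset\mathbb{N}$ there is $x_A\in E$ with $x^*(x_A)=\int_A f\,dx^*m_T$ for every $x^*\in E^*$. For $r>0$ let $\ell^r(m_T)=\{f:\ |f|^r\in\ell^1(m_T)\}$. Then the following statements are equivalent: (a) there is a continuous linear operator $S\colon\ell^p\to E$ with $S(x)=T(x)$ for all $x\in\ell^1$; (b) $\ell^p\subset\ell^1(m_T)$; (c) $\ell^1\subset\ell^{1/p}(m_T)\cap\ell^1(m_T)$; (d) there exists $C>0$ such that $$\Big\|\sum_{j\in M}x_jT(e_j)\Big\|_E\le C\Big(\sum_{j\in M}x_j^p\Big)^{1/p}$$ for all finite $M\subset\mathbb{N}$ and all $(x_j)_{j\in M}\subset[0,\infty)$. -/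

import Mathlib

open MeasureTheory Filter Topology
open scoped ENNReal

universe u v w

/-- A `δ`-ring of subsets of `Ω`: a ring of sets closed under countable intersections. -/
structure DeltaRing (Ω : Type u) where
  sets : Set (Set Ω)
  isSetRing : IsSetRing sets
  iInter_mem : ∀ A : ℕ → Set Ω, (∀ n, A n ∈ sets) → (⋂ n, A n) ∈ sets

namespace DeltaRing

variable {Ω : Type u}

/-- The `σ`-algebra `R^loc` of all sets `A` such that `A ∩ B ∈ R` for every `B ∈ R`. -/
@[reducible] def loc (R : DeltaRing Ω) : MeasurableSpace Ω where
  MeasurableSet' A := ∀ B ∈ R.sets, A ∩ B ∈ R.sets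
  measurableSet_empty := fun B _ => by
    rw [Set.empty_inter]; exact R.isSetRing.empty_mem
  measurableSet_compl := fun A hA B hB => by
    have h : Aᶜ ∩ B = B \ (A ∩ B) := by ext; simp; tauto
    rw [h]; exact R.isSetRing.sdiff_mem hB (hA B hB)
  measurableSet_iUnion := fun A hA B hB => by
    have h : (⋃ n, A n) ∩ B = B \ ⋂ n, (B \ (A n ∩ B)) := by
      ext x; simp; tauto
    rw [h]
    exact R.isSetRing.sdiff_mem hB
      (R.iInter_mem _ fun n => R.isSetRing.sdiff_mem hB (hA n B hB))

end DeltaRing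

/-- A vector measure on a `δ`-ring `R` with values in `E`: `∑ m(Aₙ)` converges to `m(⋃ Aₙ)` for
every disjoint sequence `(Aₙ)` in `R` whose union is in `R`. (The value outside `R` is irrelevant
and is set to `0`.) -/
structure DeltaMeasure {Ω : Type u} (R : DeltaRing Ω) (E : Type v)
    [NormedAddCommGroup E] where
  toFun : Set Ω → E
  eq_zero_of_notMem : ∀ A, A ∉ R.sets → toFun A = 0
  hasSum_iUnion : ∀ A : ℕ → Set Ω, (∀ n, A n ∈ R.sets) → Pairwise (Function.onFun Disjoint A) →
    (⋃ n, A n) ∈ R.sets → HasSum (fun n => toFun (A n)) (toFun (⋃ n, A n))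

namespace DeltaMeasure

variable {Ω : Type u} {R : DeltaRing Ω} {E : Type v} [NormedAddCommGroup E]

theorem toFun_empty (m : DeltaMeasure R E) : m.toFun ∅ = 0 := by
  have h := m.hasSum_iUnion (fun _ => ∅) (fun _ => R.isSetRing.empty_mem)
    (fun i j _ => by simp [Function.onFun]) (by simpa using R.isSetRing.empty_mem)
  have h0 := h.summable.tendsto_atTop_zero
  exact tendsto_nhds_unique tendsto_const_nhds h0

/-- The composition `x* m` of a vector measure with a continuous linear map. -/
def comp {F : Type w} [NormedAddCommGroup F] [NormedSpace ℝ E] [NormedSpace ℝ F]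
    (x : E →L[ℝ] F) (m : DeltaMeasure R E) : DeltaMeasure R F where
  toFun A := x (m.toFun A)
  eq_zero_of_notMem A hA := by rw [m.eq_zero_of_notMem A hA, map_zero]
  hasSum_iUnion A hA hd hU := (m.hasSum_iUnion A hA hd hU).mapL x

/-- The variation as a set function: the supremum of `∑ ‖m(B)‖` over all finite disjoint
families of members `B ⊆ A` of `R`. -/
noncomputable def variationFun (m : DeltaMeasure R E) (A : Set Ω) : ℝ≥0∞ :=
  ⨆ s : {s : Finset (Set Ω) // (∀ B ∈ s, B ∈ R.sets ∧ B ⊆ A) ∧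
    (s : Set (Set Ω)).PairwiseDisjoint id}, ∑ B ∈ s.1, ‖m.toFun B‖ₑ

theorem variationFun_mono (m : DeltaMeasure R E) {A A' : Set Ω} (h : A ⊆ A') :
    m.variationFun A ≤ m.variationFun A' :=
  iSup_le fun s => le_iSup_of_le
    ⟨s.1, fun B hB => ⟨(s.2.1 B hB).1, (s.2.1 B hB).2.trans h⟩, s.2.2⟩ le_rfl

theorem variationFun_empty (m : DeltaMeasure R E) : m.variationFun ∅ = 0 := by
  refine le_antisymm (iSup_le fun s => ?_) zero_le
  refine (Finset.sum_eq_zero fun B hB => ?_).le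
  rw [Set.subset_empty_iff.1 (s.2.1 B hB).2, m.toFun_empty, enorm_zero]

theorem variationFun_union_le (m : DeltaMeasure R E) {A A' : Set Ω} (h : Disjoint A A') :
    m.variationFun A + m.variationFun A' ≤ m.variationFun (A ∪ A') := by
  classical
  have : Nonempty {s : Finset (Set Ω) // (∀ B ∈ s, B ∈ R.sets ∧ B ⊆ A) ∧
    (s : Set (Set Ω)).PairwiseDisjoint id} := ⟨⟨∅, by simp⟩⟩
  have : Nonempty {s : Finset (Set Ω) // (∀ B ∈ s, B ∈ R.sets ∧ B ⊆ A') ∧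
    (s : Set (Set Ω)).PairwiseDisjoint id} := ⟨⟨∅, by simp⟩⟩
  refine ENNReal.iSup_add_iSup_le fun s t => ?_
  have hst : Disjoint s.1 (t.1.erase ∅) := by
    rw [Finset.disjoint_left]
    intro B hs ht
    rw [Finset.mem_erase] at ht
    exact ht.1 (Set.subset_empty_iff.1 (h (s.2.1 B hs).2 (t.2.1 B ht.2).2))
  have ht : ∑ B ∈ t.1, ‖m.toFun B‖ₑ = ∑ B ∈ t.1.erase ∅, ‖m.toFun B‖ₑ :=
    (Finset.sum_erase t.1 (f := fun B => ‖m.toFun B‖ₑ)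
      (by simp [m.toFun_empty])).symm
  rw [ht, ← Finset.sum_union hst]
  refine le_iSup_of_le ⟨s.1 ∪ t.1.erase ∅, ?_, ?_⟩ le_rfl
  · intro B hB
    rcases Finset.mem_union.1 hB with hB | hB
    · exact ⟨(s.2.1 B hB).1, (s.2.1 B hB).2.trans Set.subset_union_left⟩
    · have hB := Finset.mem_of_mem_erase hB
      exact ⟨(t.2.1 B hB).1, (t.2.1 B hB).2.trans Set.subset_union_right⟩
  · intro B hB C hC hBC
    rcases Finset.mem_union.1 hB with hB | hB <;> rcases Finset.mem_union.1 hC with hC | hC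
    · exact s.2.2 hB hC hBC
    · exact h.mono (s.2.1 B hB).2 (t.2.1 C (Finset.mem_of_mem_erase hC)).2
    · exact h.symm.mono (t.2.1 B (Finset.mem_of_mem_erase hB)).2 (s.2.1 C hC).2
    · exact t.2.2 (Finset.mem_of_mem_erase hB) (Finset.mem_of_mem_erase hC) hBC

theorem variationFun_iUnion (m : DeltaMeasure R E) (A : ℕ → Set Ω)
    (hA : ∀ n, ∀ B ∈ R.sets, A n ∩ B ∈ R.sets) (hd : Pairwise (Function.onFun Disjoint A)) :
    m.variationFun (⋃ n, A n) = ∑' n, m.variationFun (A n) := by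
  classical
  apply le_antisymm
  · refine iSup_le fun s => ?_
    have h1 : ∀ B ∈ s.1, ‖m.toFun B‖ₑ ≤ ∑' n, ‖m.toFun (A n ∩ B)‖ₑ := by
      intro B hB
      have hU : (⋃ n, A n ∩ B) = B := by
        rw [← Set.iUnion_inter]; exact Set.inter_eq_right.2 (s.2.1 B hB).2
      have hs := m.hasSum_iUnion (fun n => A n ∩ B) (fun n => hA n B (s.2.1 B hB).1)
        (fun i j hij => (hd hij).mono Set.inter_subset_left Set.inter_subset_left)
        (by rw [hU]; exact (s.2.1 B hB).1)
      rw [hU] at hs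
      rw [← hs.tsum_eq]
      exact enorm_tsum_le_tsum_enorm
    calc ∑ B ∈ s.1, ‖m.toFun B‖ₑ ≤ ∑ B ∈ s.1, ∑' n, ‖m.toFun (A n ∩ B)‖ₑ :=
          Finset.sum_le_sum h1
      _ = ∑' n, ∑ B ∈ s.1, ‖m.toFun (A n ∩ B)‖ₑ :=
          (Summable.tsum_finsetSum fun _ _ => ENNReal.summable).symm
      _ ≤ ∑' n, m.variationFun (A n) := by
          refine ENNReal.tsum_le_tsum fun n => ?_
          have himg : ∑ B ∈ s.1, ‖m.toFun (A n ∩ B)‖ₑ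
              = ∑ C ∈ Finset.image (fun B => A n ∩ B) s.1, ‖m.toFun C‖ₑ := by
            refine (Finset.sum_image_of_pairwise_eq_zero (I := s.1)
              (f := fun B => A n ∩ B) (g := fun C => ‖m.toFun C‖ₑ) ?_).symm
            intro B hB C hC hBC hEq
            have hdis : Disjoint (A n ∩ B) (A n ∩ C) :=
              (s.2.2 hB hC hBC).mono Set.inter_subset_right Set.inter_subset_right
            have hEq' : A n ∩ B = A n ∩ C := hEq
            rw [← hEq', disjoint_self] at hdis
            change ‖m.toFun (A n ∩ B)‖ₑ = 0
            rw [hdis]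
            simp [m.toFun_empty]
          rw [himg]
          refine le_iSup_of_le ⟨s.1.image (fun B => A n ∩ B), ?_, ?_⟩ le_rfl
          · intro C hC
            obtain ⟨B, hB, rfl⟩ := Finset.mem_image.1 hC
            exact ⟨hA n B (s.2.1 B hB).1, Set.inter_subset_left⟩
          · intro C hC D hD hCD
            obtain ⟨B, hB, rfl⟩ := Finset.mem_image.1 hC
            obtain ⟨B', hB', rfl⟩ := Finset.mem_image.1 hD
            have hne : B ≠ B' := fun h => hCD (by rw [h])
            exact (s.2.2 hB hB' hne).mono Set.inter_subset_right Set.inter_subset_right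
  · refine ENNReal.summable.tsum_le_of_sum_le fun t => ?_
    have key : ∑ n ∈ t, m.variationFun (A n) ≤ m.variationFun (⋃ n ∈ t, A n) := by
      induction t using Finset.induction_on with
      | empty => simp
      | insert a t ha ih =>
        rw [Finset.sum_insert ha, Finset.set_biUnion_insert]
        refine le_trans (add_le_add le_rfl ih) (m.variationFun_union_le ?_)
        rw [Set.disjoint_iUnion₂_right]
        intro n hn
        exact hd (fun h => ha (h ▸ hn))
    exact key.trans (m.variationFun_mono (Set.iUnion₂_subset fun n _ => Set.subset_iUnion A n))

/-- The variation `|m|`, a measure on `R^loc`. -/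
noncomputable def variation (m : DeltaMeasure R E) : @Measure Ω R.loc :=
  @Measure.ofMeasurable Ω R.loc (fun A _ => m.variationFun A) m.variationFun_empty
    (fun A hA hd => m.variationFun_iUnion A hA hd)

theorem variation_apply (m : DeltaMeasure R E) {A : Set Ω} (hA : MeasurableSet[R.loc] A) :
    m.variation A = m.variationFun A := by
  let _ : MeasurableSpace Ω := R.loc
  exact @Measure.ofMeasurable_apply Ω R.loc _ m.variationFun_empty
    (fun A hA hd => m.variationFun_iUnion A hA hd) A hA

/-- `∫_A φ dλ = ∑ αⱼ λ(Aⱼ ∩ A)` for a simple function `φ = ∑ αⱼ χ_{Aⱼ}` in canonical form;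
meaningful when the support of `φ` is in `R`. -/
noncomputable def simpleIntegral (l : DeltaMeasure R ℝ) (φ : @SimpleFunc Ω R.loc ℝ)
    (A : Set Ω) : ℝ :=
  ∑ a ∈ @SimpleFunc.range Ω ℝ R.loc φ, a * l.toFun (φ ⁻¹' {a} ∩ A)

/-- `f ∈ L¹(λ)` and `∫_A f dλ = c` for a real measure `λ` on a `δ`-ring: `c` is the limit of
`∫_A φₙ dλ` for a sequence of simple functions with support in `R` that converges to `f` in
`L¹(|λ|)`. -/
def HasRealIntegral (l : DeltaMeasure R ℝ) (f : Ω → ℝ) (A : Set Ω) (c : ℝ) : Prop :=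
  Integrable f l.variation ∧
  ∃ φ : ℕ → @SimpleFunc Ω R.loc ℝ,
    (∀ n, Function.support (φ n) ∈ R.sets) ∧
    Tendsto (fun n => ∫⁻ t, ‖φ n t - f t‖ₑ ∂l.variation) atTop (𝓝 0) ∧
    Tendsto (fun n => l.simpleIntegral (φ n) A) atTop (𝓝 c)

variable [NormedSpace ℝ E]

/-- The functions in `L¹(m)`, given by representatives (which are determined up to `m`-null sets;
when `T e_n ≠ 0` for all `n`, the measure `m_T` below has no null set except `∅`): the `R^loc`-measurable `f` such that
`f ∈ L¹(x* m)` for every `x* ∈ E*` and, for each `A ∈ R^loc`, there is `x_A ∈ E` with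
`x*(x_A) = ∫_A f d(x* m)` for every `x* ∈ E*`. -/
def L1 (m : DeltaMeasure R E) : Set (Ω → ℝ) :=
  {f | Measurable[R.loc] f ∧
    (∀ x : E →L[ℝ] ℝ, Integrable f (m.comp x).variation) ∧
    ∀ A : Set Ω, MeasurableSet[R.loc] A →
      ∃ y : E, ∀ x : E →L[ℝ] ℝ, (m.comp x).HasRealIntegral f A (x y)}

/-- The space `L^r(m)`, `r > 0`: the `r`-power `{f : |f|^r ∈ L¹(m)}` of `L¹(m)`. -/
def LPow (m : DeltaMeasure R E) (r : ℝ) : Set (Ω → ℝ) :=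
  {f | Measurable[R.loc] f ∧ (fun t => |f t| ^ r) ∈ m.L1}

end DeltaMeasure

/-- The `δ`-ring of all finite subsets of `ℕ`, i.e. of the sets `A` with `χ_A ∈ ℓ¹`. -/
def finiteSets : DeltaRing ℕ where
  sets := {A | A.Finite}
  isSetRing :=
    { empty_mem := Set.finite_empty
      union_mem := fun _ _ hs ht => Set.Finite.union hs ht
      sdiff_mem := fun _ _ hs _ => Set.Finite.subset hs Set.sdiff_subset }
  iInter_mem := fun A hA => Set.Finite.subset (hA 0) (Set.iInter_subset A 0)

/-- The real sequence space `ℓ^p` as a set of sequences. -/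
def ellSet (p : ℝ) : Set (ℕ → ℝ) := {x | Memℓp x (ENNReal.ofReal p)}

/-- The Banach space `ℓ¹` of real sequences. -/
abbrev Ell1 : Type := lp (fun _ : ℕ => ℝ) 1

namespace Ell1

/-- The characteristic function `χ_A ∈ ℓ¹` of a finite set `A`. -/
noncomputable def chi (A : Set ℕ) (hA : A.Finite) : Ell1 :=
  ⟨A.indicator fun _ => (1 : ℝ), (memℓp_zero (hA.subset fun n hn => by
    by_contra h
    exact hn (Set.indicator_of_notMem h _))).of_exponent_ge zero_le⟩

/-- The unit vector `e_n = χ_{n}`. -/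
noncomputable def e (n : ℕ) : Ell1 := chi {n} (Set.finite_singleton n)

theorem chi_eq_sum (A : Finset ℕ) : chi (A : Set ℕ) A.finite_toSet = ∑ n ∈ A, e n := by
  ext k
  rw [lp.coeFn_sum, Finset.sum_apply]
  simp [chi, e, Set.indicator_apply]

end Ell1

section Operators

variable {E : Type v} [NormedAddCommGroup E] [NormedSpace ℝ E]

open Classical in
/-- The vector measure `m_T(A) = T(χ_A)` on the finite subsets of `ℕ` associated with a continuous
linear operator `T : ℓ¹ → E`. -/
noncomputable def assocMeasure (T : Ell1 →L[ℝ] E) : DeltaMeasure finiteSets E where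
  toFun A := if hA : A.Finite then T (Ell1.chi A hA) else 0
  eq_zero_of_notMem A hA := dif_neg hA
  hasSum_iUnion A hA hd hU := by
    have hU' : (⋃ n, A n).Finite := hU
    have hA' : ∀ n, (A n).Finite := hA
    have hfin : {n | (A n).Nonempty}.Finite := by
      have hex : ∀ n : {n | (A n).Nonempty}, ∃ k : (⋃ n, A n : Set ℕ), (k : ℕ) ∈ A n :=
        fun n => ⟨⟨n.2.some, Set.mem_iUnion.2 ⟨n, n.2.some_mem⟩⟩, n.2.some_mem⟩
      choose g hg using hex
      have : Finite (⋃ n, A n : Set ℕ) := hU'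
      have hinj : Function.Injective g := by
        intro i j hij
        by_contra hne
        have h1 := hg i
        rw [hij] at h1
        exact Set.disjoint_left.1 (hd fun h => hne (Subtype.ext h)) h1 (hg j)
      exact Set.finite_coe_iff.1 (Finite.of_injective g hinj)
    have hUeq : (⋃ n ∈ hfin.toFinset, A n) = ⋃ n, A n := by
      ext k
      simp only [Set.mem_iUnion, Set.Finite.mem_toFinset, Set.mem_ofPred_eq, exists_prop]
      exact ⟨fun ⟨n, _, h⟩ => ⟨n, h⟩, fun ⟨n, h⟩ => ⟨n, ⟨k, h⟩, h⟩⟩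
    have hsum : Ell1.chi (⋃ n, A n) hU' = ∑ n ∈ hfin.toFinset, Ell1.chi (A n) (hA' n) := by
      ext k
      rw [lp.coeFn_sum, Finset.sum_apply]
      have h := Finset.indicator_biUnion hfin.toFinset A
        (fun i _ j _ hij => hd hij) (f := fun _ : ℕ => (1 : ℝ))
      rw [hUeq] at h
      exact congrFun h k
    rw [dif_pos hU', hsum, map_sum]
    have hfun : (fun n => if hn : (A n).Finite then T (Ell1.chi (A n) hn) else 0)
        = fun n => T (Ell1.chi (A n) (hA' n)) := funext fun n => dif_pos (hA' n)
    rw [hfun]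
    refine hasSum_sum_of_ne_finset_zero fun n hn => ?_
    have hn0 : A n = ∅ := by
      rw [Set.Finite.mem_toFinset] at hn
      exact Set.not_nonempty_iff_eq_empty.1 hn
    have hz : Ell1.chi (A n) (hA' n) = 0 := by
      ext k
      simp [Ell1.chi, hn0]
    rw [hz, map_zero]

/-- For `1 < p < ∞`: there is a continuous linear operator `S : ℓ^p → E` that extends `T`. -/
def ExtendsToEll (T : Ell1 →L[ℝ] E) (p : ℝ) (hp : 1 < p) : Prop :=
  haveI : Fact ((1 : ℝ≥0∞) ≤ ENNReal.ofReal p) := ⟨ENNReal.one_le_ofReal.2 hp.le⟩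
  ∃ S : lp (fun _ : ℕ => ℝ) (ENNReal.ofReal p) →L[ℝ] E,
    ∀ x : Ell1, S ⟨x, lp.monotone (ENNReal.one_le_ofReal.2 hp.le) x.2⟩ = T x

end Operators

/-!
A vector measure `m` on the finite subsets of `ℕ` is determined by the sequence `v n = m {n}`, and
`|x* m|` is the weighted counting measure with weights `|x* (v n)|`. Hence `f ∈ L¹(m)` forces
`∑ f n • v n` to be weakly absolutely summable, while unconditional summability of this series is
enough for `f ∈ L¹(m)`. Two applications of the Banach–Steinhaus theorem turn weak absolute
summability for all `f ∈ ℓ^p` into the estimate `‖∑ x n • v n‖ ≤ C ‖x‖_p` for finite sums, which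
defines an operator on `ℓ^p`, and an operator on `ℓ^p` makes `∑ f n • v n` summable for all
`f ∈ ℓ^p`. The power `f ↦ |f| ^ p` carries `ℓ^p` to `ℓ^1`, and an estimate for nonnegative
coefficients only costs a factor `2`.
-/

section UpperEstimates

variable {ι 𝕜 E : Type*} [DecidableEq ι] [NormedAddCommGroup E] {q : ℝ≥0∞}

section NormedField

variable [NormedField 𝕜] [NormedSpace 𝕜 E]

variable (𝕜 q) in
/-- The family `v` satisfies an upper `ℓ^q` estimate with constant `K`: finite linear combinations
are bounded by `K` times the `ℓ^q` norm of the coefficients, which are regarded as a finitely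
supported element of `ℓ^q` so that all `q`, including `∞`, are treated alike. -/
def HasUpperEstimate (v : ι → E) (K : ℝ) : Prop :=
  ∀ (M : Finset ι) (x : ι → 𝕜),
    ‖∑ i ∈ M, x i • v i‖ ≤ K * ‖(∑ i ∈ M, lp.single q i (x i) : lp (fun _ : ι => 𝕜) q)‖

theorem norm_sum_single_eq (hq : 0 < q.toReal) (M : Finset ι) (x : ι → 𝕜) :
    ‖(∑ i ∈ M, lp.single q i (x i) : lp (fun _ : ι => 𝕜) q)‖ =
      (∑ i ∈ M, ‖x i‖ ^ q.toReal) ^ (1 / q.toReal) := by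
  rw [← lp.norm_sum_single hq x M, one_div, Real.rpow_rpow_inv (lp.norm_nonneg' _) hq.ne']

variable [Fact (1 ≤ q)]

theorem hasSum_smul_apply_single (hq : q ≠ ∞) (S : lp (fun _ : ι => 𝕜) q →L[𝕜] E)
    (f : lp (fun _ : ι => 𝕜) q) : HasSum (fun i => f i • S (lp.single q i 1)) (S f) := by
  refine ((lp.hasSum_single hq f).mapL S).congr_fun fun i => ?_
  rw [← map_smul, ← lp.single_smul, smul_eq_mul, mul_one]

namespace HasUpperEstimate

variable [CompleteSpace E] {v : ι → E} {K : ℝ}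

theorem summable_smul (h : HasUpperEstimate 𝕜 q v K) (hq : q ≠ ∞) (f : lp (fun _ : ι => 𝕜) q) :
    Summable fun i => f i • v i := by
  rw [summable_iff_vanishing_norm]
  intro ε hε
  have hK : 0 < max K 1 := by positivity
  have hcauchy : CauchySeq fun t => ∑ i ∈ t, lp.single q i (f i) :=
    (lp.hasSum_single hq f).cauchySeq
  obtain ⟨s, hs⟩ := cauchySeq_finset_iff_vanishing_norm.1 hcauchy _ (div_pos hε hK)
  refine ⟨s, fun t ht => ?_⟩
  calc ‖∑ i ∈ t, f i • v i‖
      ≤ K * ‖∑ i ∈ t, lp.single q i (f i)‖ := h t f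
    _ ≤ max K 1 * ‖∑ i ∈ t, lp.single q i (f i)‖ := by gcongr; exact le_max_left K 1
    _ < max K 1 * (ε / max K 1) := by gcongr; exact hs t ht
    _ = ε := mul_div_cancel₀ ε hK.ne'

theorem exists_continuousLinearMap (h : HasUpperEstimate 𝕜 q v K) (hq : q ≠ ∞) :
    ∃ S : lp (fun _ : ι => 𝕜) q →L[𝕜] E, ∀ i, S (lp.single q i 1) = v i := by
  have hs := h.summable_smul hq
  let L : lp (fun _ : ι => 𝕜) q →ₗ[𝕜] E :=
    { toFun f := ∑' i, f i • v i
      map_add' f g := by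
        simp only [lp.coeFn_add, Pi.add_apply, add_smul]
        exact (hs f).tsum_add (hs g)
      map_smul' c f := by
        simp only [lp.coeFn_smul, Pi.smul_apply, smul_assoc, RingHom.id_apply]
        exact (hs f).tsum_const_smul c }
  have hL (f) : ‖L f‖ ≤ K * ‖f‖ :=
    le_of_tendsto_of_tendsto' (hs f).hasSum.norm ((lp.hasSum_single hq f).norm.const_mul K)
      fun M => h M f
  refine ⟨L.mkContinuous K hL, fun i => ?_⟩
  change ∑' j, (lp.single q i 1 : lp (fun _ : ι => 𝕜) q) j • v j = v i
  rw [tsum_eq_single i fun j hj => by rw [lp.single_apply_ne _ _ _ hj, zero_smul],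
    lp.single_apply_self, one_smul]

end HasUpperEstimate

end NormedField

theorem HasUpperEstimate.of_nonneg [NormedSpace ℝ E] (hq : q ≠ 0) {v : ι → E} {C : ℝ} (hC : 0 ≤ C)
    (h : ∀ (M : Finset ι) (x : ι → ℝ), (∀ i, 0 ≤ x i) →
      ‖∑ i ∈ M, x i • v i‖ ≤ C * ‖(∑ i ∈ M, lp.single q i (x i) : lp (fun _ : ι => ℝ) q)‖) :
    HasUpperEstimate ℝ q v (2 * C) := by
  intro M x
  have hpart (y : ι → ℝ) (hy : ∀ i, 0 ≤ y i) (hyx : ∀ i, y i ≤ |x i|) :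
      ‖∑ i ∈ M, y i • v i‖ ≤ C * ‖(∑ i ∈ M, lp.single q i (x i) : lp (fun _ : ι => ℝ) q)‖ := by
    refine (h M y hy).trans (mul_le_mul_of_nonneg_left (lp.norm_mono hq fun i => ?_) hC)
    simp only [lp.coeFn_sum, Finset.sum_apply, lp.single_apply, Finset.sum_pi_single]
    split_ifs
    · simpa only [Real.norm_eq_abs, abs_of_nonneg (hy i)] using hyx i
    · rfl
  have hpos := hpart (fun i => (x i)⁺) (fun i => posPart_nonneg _)
    fun i => sup_le (le_abs_self _) (abs_nonneg _)
  have hneg := hpart (fun i => (x i)⁻) (fun i => negPart_nonneg _)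
    fun i => sup_le (neg_le_abs _) (abs_nonneg _)
  calc ‖∑ i ∈ M, x i • v i‖
      = ‖∑ i ∈ M, (x i)⁺ • v i - ∑ i ∈ M, (x i)⁻ • v i‖ := by
        simp only [← Finset.sum_sub_distrib, ← sub_smul, posPart_sub_negPart]
    _ ≤ ‖∑ i ∈ M, (x i)⁺ • v i‖ + ‖∑ i ∈ M, (x i)⁻ • v i‖ := norm_sub_le _ _
    _ ≤ 2 * C * ‖(∑ i ∈ M, lp.single q i (x i) : lp (fun _ : ι => ℝ) q)‖ := by linarith

theorem exists_hasUpperEstimate_ofReal_iff [NormedSpace ℝ E] {p : ℝ} (hp : 0 < p) {v : ι → E} :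
    (∃ K, HasUpperEstimate ℝ (ENNReal.ofReal p) v K) ↔
      ∃ C : ℝ, 0 < C ∧ ∀ (M : Finset ι) (x : ι → ℝ), (∀ i ∈ M, 0 ≤ x i) →
        ‖∑ i ∈ M, x i • v i‖ ≤ C * (∑ i ∈ M, x i ^ p) ^ (1 / p) := by
  have hq : (ENNReal.ofReal p).toReal = p := ENNReal.toReal_ofReal hp.le
  have hnorm (M : Finset ι) (x : ι → ℝ) (hx : ∀ i ∈ M, 0 ≤ x i) :
      ‖(∑ i ∈ M, lp.single _ i (x i) : lp (fun _ : ι => ℝ) (ENNReal.ofReal p))‖ =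
        (∑ i ∈ M, x i ^ p) ^ (1 / p) := by
    rw [norm_sum_single_eq (hq.symm ▸ hp), hq,
      Finset.sum_congr rfl fun i hi => by rw [Real.norm_of_nonneg (hx i hi)]]
  constructor
  · rintro ⟨K, hK⟩
    refine ⟨max K 1, by positivity, fun M x hx => ?_⟩
    rw [← hnorm M x hx]
    exact (hK M x).trans (mul_le_mul_of_nonneg_right (le_max_left K 1) (lp.norm_nonneg' _))
  · rintro ⟨C, hC, h⟩
    refine ⟨2 * C, .of_nonneg (ENNReal.ofReal_pos.2 hp).ne' hC.le fun M x hx => ?_⟩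
    rw [hnorm M x fun i _ => hx i]
    exact h M x fun i _ => hx i

theorem exists_norm_le_of_forall_dual_exists_norm_le [RCLike 𝕜] [NormedSpace 𝕜 E] {α : Type*}
    {y : α → E} (h : ∀ x : StrongDual 𝕜 E, ∃ C, ∀ a, ‖x (y a)‖ ≤ C) : ∃ C, ∀ a, ‖y a‖ ≤ C := by
  obtain ⟨C, hC⟩ := banach_steinhaus (g := fun a => NormedSpace.inclusionInDoubleDualLi 𝕜 (y a)) h
  exact ⟨C, fun a => by simpa only [LinearIsometry.norm_map] using hC a⟩

theorem exists_hasUpperEstimate_of_weakly_summable [RCLike 𝕜] [NormedSpace 𝕜 E] [Fact (1 ≤ q)]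
    {v : ι → E} (h : ∀ (f : lp (fun _ : ι => 𝕜) q) (x : StrongDual 𝕜 E),
      Summable fun i => ‖f i‖ * ‖x (v i)‖) : ∃ K, HasUpperEstimate 𝕜 q v K := by
  let S (M : Finset ι) : lp (fun _ : ι => 𝕜) q →L[𝕜] E :=
    ∑ i ∈ M, (lp.evalCLM 𝕜 (fun _ : ι => 𝕜) q i).smulRight (v i)
  have hS (M f) : S M f = ∑ i ∈ M, f i • v i := by
    simp only [S, sum_apply, ContinuousLinearMap.smulRight_apply]
    rfl
  have hbounded (f) : ∃ C, ∀ M, ‖S M f‖ ≤ C := by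
    refine exists_norm_le_of_forall_dual_exists_norm_le (𝕜 := 𝕜) fun x =>
      ⟨∑' i, ‖f i‖ * ‖x (v i)‖, fun M => ?_⟩
    calc ‖x (S M f)‖ = ‖∑ i ∈ M, f i * x (v i)‖ := by
          simp only [hS, map_sum, map_smul, smul_eq_mul]
      _ ≤ ∑ i ∈ M, ‖f i‖ * ‖x (v i)‖ := norm_sum_le_of_le _ fun i _ => norm_mul_le _ _
      _ ≤ ∑' i, ‖f i‖ * ‖x (v i)‖ := (h f x).sum_le_tsum M fun _ _ => by positivity
  obtain ⟨K, hK⟩ := banach_steinhaus hbounded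
  refine ⟨K, fun M x => ?_⟩
  let g : lp (fun _ : ι => 𝕜) q := ∑ i ∈ M, lp.single q i (x i)
  have hg : ∀ i ∈ M, g i = x i := fun i hi => by
    simp only [g, lp.coeFn_sum, Finset.sum_apply, lp.single_apply, Finset.sum_pi_single, if_pos hi]
  rw [← Finset.sum_congr rfl fun i hi => congrArg (· • v i) (hg i hi), ← hS]
  exact (S M).le_of_opNorm_le (hK M) g

end UpperEstimates

instance discreteMeasurableSpace_finiteSets_loc : @DiscreteMeasurableSpace ℕ finiteSets.loc :=
  @DiscreteMeasurableSpace.mk ℕ finiteSets.loc fun _ _ hB => hB.subset Set.inter_subset_right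

namespace DeltaMeasure

section SequenceMeasures

variable {E : Type*} [NormedAddCommGroup E] (m : DeltaMeasure finiteSets E)

theorem toFun_coe_finset (B : Finset ℕ) : m.toFun B = ∑ n ∈ B, m.toFun {n} := by
  let A (n : ℕ) : Set ℕ := {n} ∩ B
  have hunion : ⋃ n, A n = B := by
    rw [← Set.iUnion_inter, Set.iUnion_of_singleton, Set.univ_inter]
  have hsum : HasSum (fun n => m.toFun (A n)) (m.toFun B) := by
    rw [← hunion]
    refine m.hasSum_iUnion A (fun n => ?_) (fun i j hij => ?_) (hunion ▸ B.finite_toSet)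
    · exact (Set.finite_singleton n).inter_of_left _
    · exact (Set.disjoint_singleton.2 hij).mono Set.inter_subset_left Set.inter_subset_left
  have hmem : ∀ n ∈ B, A n = {n} := fun n hn =>
    Set.inter_eq_left.2 (Set.singleton_subset_iff.2 hn)
  have hnotMem : ∀ n ∉ B, A n = ∅ := fun n hn => Set.singleton_inter_eq_empty.2 hn
  rw [← Finset.sum_congr rfl fun n hn => congrArg m.toFun (hmem n hn)]
  refine hsum.unique (hasSum_sum_of_ne_finset_zero fun n hn => ?_)
  rw [hnotMem n hn, m.toFun_empty]

theorem variationFun_singleton (n : ℕ) : m.variationFun {n} = ‖m.toFun {n}‖ₑ := by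
  classical
  refine le_antisymm (iSup_le fun s => ?_) ?_
  · have hsub : s.1 ⊆ {∅, {n}} := fun B hB => by
      simpa using Set.subset_singleton_iff_eq.1 (s.2.1 B hB).2
    refine (Finset.sum_le_sum_of_subset hsub).trans_eq ?_
    rw [Finset.sum_pair (Set.singleton_ne_empty n).symm, m.toFun_empty, enorm_zero, zero_add]
  · refine le_iSup_of_le ⟨{{n}}, fun B hB => ?_, ?_⟩ (Finset.sum_singleton _ _).ge
    · rw [Finset.mem_singleton.1 hB]
      exact ⟨Set.finite_singleton n, subset_rfl⟩
    · rw [Finset.coe_singleton]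
      exact Set.pairwiseDisjoint_singleton _ _

theorem lintegral_variation (g : ℕ → ℝ≥0∞) :
    ∫⁻ n, g n ∂m.variation = ∑' n, g n * ‖m.toFun {n}‖ₑ := by
  let _ : MeasurableSpace ℕ := finiteSets.loc
  rw [lintegral_countable']
  exact tsum_congr fun n => by
    rw [variation_apply _ MeasurableSet.of_discrete, variationFun_singleton]

theorem integrable_variation_iff {F : Type*} [NormedAddCommGroup F] (f : ℕ → F) :
    Integrable f m.variation ↔ Summable fun n => ‖f n‖ * ‖m.toFun {n}‖ := by
  let _ : MeasurableSpace ℕ := finiteSets.loc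
  have hmeas : AEStronglyMeasurable f m.variation := .of_discrete
  have hterm (n) : ‖f n‖ₑ * ‖m.toFun {n}‖ₑ = ‖‖f n‖ * ‖m.toFun {n}‖‖ₑ := by
    rw [enorm_mul, enorm_norm, enorm_norm]
  rw [Integrable, and_iff_right hmeas, hasFiniteIntegral_iff_enorm, lintegral_variation,
    lt_top_iff_ne_top, tsum_congr hterm, tsum_enorm_ne_top_iff_summable_norm]
  simp only [norm_mul, norm_norm]

end SequenceMeasures

section SimpleIntegral

variable (l : DeltaMeasure finiteSets ℝ)

theorem simpleIntegral_eq_sum (φ : @SimpleFunc ℕ finiteSets.loc ℝ) {M : Finset ℕ}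
    (hM : Function.support φ ⊆ M) (A : Set ℕ) :
    l.simpleIntegral φ A = ∑ n ∈ M, A.indicator φ n * l.toFun {n} := by
  classical
  let _ : MeasurableSpace ℕ := finiteSets.loc
  have hfiber (a : ℝ) : a * l.toFun (φ ⁻¹' {a} ∩ A) =
      ∑ n ∈ M with φ n = a, A.indicator φ n * l.toFun {n} := by
    rcases eq_or_ne a 0 with rfl | ha
    · rw [zero_mul, Finset.sum_eq_zero]
      intro n hn
      rw [Set.indicator_apply, (Finset.mem_filter.1 hn).2, ite_self, zero_mul]
    · have hset : φ ⁻¹' {a} ∩ A = ({n ∈ {n ∈ M | φ n = a} | n ∈ A} : Finset ℕ) := by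
        ext n
        simp only [Set.mem_inter_iff, Set.mem_preimage, Set.mem_singleton_iff, Finset.mem_coe,
          Finset.mem_filter, and_congr_left_iff, iff_and_self]
        exact fun _ hn => hM (Function.mem_support.2 (hn ▸ ha))
      rw [hset, toFun_coe_finset, Finset.sum_filter, Finset.mul_sum]
      refine Finset.sum_congr rfl fun n hn => ?_
      rw [Set.indicator_apply, (Finset.mem_filter.1 hn).2, mul_ite, ite_mul, mul_zero, zero_mul]
  rw [simpleIntegral, Finset.sum_congr rfl fun a _ => hfiber a]
  exact Finset.sum_fiberwise_of_maps_to (fun n _ => φ.mem_range_self n) _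

/-- The restriction of `f` to `{0, …, N - 1}`, extended by zero: the simple functions that
approximate `f` in `L¹(|l|)` for every real measure `l` with `f ∈ L¹(|l|)`. -/
noncomputable def truncation (f : ℕ → ℝ) (N : ℕ) : @SimpleFunc ℕ finiteSets.loc ℝ :=
  @SimpleFunc.mk ℕ finiteSets.loc ℝ ((Finset.range N : Set ℕ).indicator f)
    (fun _ => @MeasurableSet.of_discrete ℕ finiteSets.loc _ _)
    (((Finset.range N).finite_toSet.subset Set.support_indicator_subset).image _ |>.insert 0
      |>.subset <| Function.range_subset_insert_image_support _)

theorem coe_truncation (f : ℕ → ℝ) (N : ℕ) :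
    ⇑(truncation f N) = (Finset.range N : Set ℕ).indicator f := rfl

theorem support_truncation_subset (f : ℕ → ℝ) (N : ℕ) :
    Function.support (truncation f N) ⊆ Finset.range N :=
  Set.support_indicator_subset

theorem simpleIntegral_truncation (f : ℕ → ℝ) (N : ℕ) (A : Set ℕ) :
    l.simpleIntegral (truncation f N) A =
      ∑ n ∈ Finset.range N, A.indicator f n * l.toFun {n} := by
  rw [simpleIntegral_eq_sum l _ (support_truncation_subset f N)]
  refine Finset.sum_congr rfl fun n hn => ?_
  rw [coe_truncation, Set.indicator_indicator, Set.inter_comm, ← Set.indicator_indicator,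
    Set.indicator_of_mem (Finset.mem_coe.2 hn)]

theorem tendsto_lintegral_truncation_sub {f : ℕ → ℝ} (hf : Integrable f l.variation) :
    Tendsto (fun N => ∫⁻ n, ‖truncation f N n - f n‖ₑ ∂l.variation) atTop (𝓝 0) := by
  let _ : MeasurableSpace ℕ := finiteSets.loc
  have hsub (N n : ℕ) : truncation f N n - f n = -((Finset.range N : Set ℕ)ᶜ.indicator f n) := by
    rw [coe_truncation, Set.indicator_compl, Pi.sub_apply, neg_sub]
  have hlim : Tendsto (fun N => ∫⁻ n, ‖truncation f N n - f n‖ₑ ∂l.variation) atTop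
      (𝓝 (∫⁻ _, 0 ∂l.variation)) := by
    refine tendsto_lintegral_of_dominated_convergence (fun n => ‖f n‖ₑ)
      (fun N => .of_discrete) (fun N => .of_forall fun n => ?_) hf.2.ne (.of_forall fun n => ?_)
    · dsimp only
      rw [hsub, enorm_neg]
      exact enorm_indicator_le_enorm_self _ _
    · refine tendsto_const_nhds.congr' ?_
      filter_upwards [eventually_gt_atTop n] with N hN
      rw [coe_truncation, Set.indicator_of_mem (Finset.mem_coe.2 (Finset.mem_range.2 hN)), sub_self,
        enorm_zero]
  simpa only [lintegral_zero] using hlim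

theorem hasRealIntegral_of_hasSum {f : ℕ → ℝ} (hf : Integrable f l.variation) {A : Set ℕ} {c : ℝ}
    (hc : HasSum (fun n => A.indicator f n * l.toFun {n}) c) : l.HasRealIntegral f A c := by
  refine ⟨hf, truncation f, fun N => ?_, l.tendsto_lintegral_truncation_sub hf, ?_⟩
  · exact (Finset.range N).finite_toSet.subset (support_truncation_subset f N)
  · simp only [simpleIntegral_truncation]
    exact hc.tendsto_sum_nat

end SimpleIntegral

section L1

variable {E : Type*} [NormedAddCommGroup E] [NormedSpace ℝ E] {m : DeltaMeasure finiteSets E}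
  {f : ℕ → ℝ}

theorem summable_norm_mul_norm_of_mem_L1 (hf : f ∈ m.L1) (x : StrongDual ℝ E) :
    Summable fun n => ‖f n‖ * ‖x (m.toFun {n})‖ :=
  ((m.comp x).integrable_variation_iff f).1 (hf.2.1 x)

theorem mem_L1_of_summable [CompleteSpace E] (hf : Summable fun n => f n • m.toFun {n}) :
    f ∈ m.L1 := by
  have hintegrable (x : E →L[ℝ] ℝ) : Integrable f (m.comp x).variation := by
    refine (integrable_variation_iff _ f).2 ((hf.mapL x).norm.congr fun n => ?_)
    rw [map_smul, smul_eq_mul, norm_mul]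
    rfl
  refine ⟨@Measurable.of_discrete _ _ finiteSets.loc _ _ _, hintegrable, fun A _ => ?_⟩
  refine ⟨_, fun x => hasRealIntegral_of_hasSum _ (hintegrable x)
    (((hf.indicator A).hasSum.mapL x).congr_fun fun n => ?_)⟩
  rw [Set.indicator_smul_apply_left, map_smul, smul_eq_mul]
  rfl

end L1

end DeltaMeasure

section PowerSequences

variable {p r : ℝ} {f : ℕ → ℝ}

theorem mem_ellSet_iff (hp : 0 < p) : f ∈ ellSet p ↔ Summable fun n => |f n| ^ p := by
  have hq := ENNReal.toReal_ofReal hp.le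
  rw [ellSet, Set.mem_ofPred_eq, memℓp_gen_iff (hq.symm ▸ hp), hq]
  rfl

theorem abs_rpow_mem_ellSet_iff (hp : 0 < p) (hr : 0 < r) :
    (fun n => |f n| ^ r) ∈ ellSet p ↔ f ∈ ellSet (r * p) := by
  rw [mem_ellSet_iff hp, mem_ellSet_iff (mul_pos hr hp)]
  simp only [Real.abs_rpow_of_nonneg (abs_nonneg _), abs_abs, Real.rpow_mul (abs_nonneg _)]

end PowerSequences

section Characterizations

variable {E : Type*} [NormedAddCommGroup E] [NormedSpace ℝ E] {m : DeltaMeasure finiteSets E}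
  {p : ℝ}

theorem ellSet_subset_L1_of_continuousLinearMap [CompleteSpace E] [Fact (1 ≤ ENNReal.ofReal p)]
    (S : lp (fun _ : ℕ => ℝ) (ENNReal.ofReal p) →L[ℝ] E)
    (hS : ∀ n, S (lp.single _ n 1) = m.toFun {n}) : ellSet p ⊆ m.L1 := fun f hf =>
  DeltaMeasure.mem_L1_of_summable <| by
    simpa only [hS] using (hasSum_smul_apply_single ENNReal.ofReal_ne_top S ⟨f, hf⟩).summable

theorem ellSet_one_subset_LPow (hp : 0 < p) (h : ellSet p ⊆ m.L1) :
    ellSet 1 ⊆ m.LPow (1 / p) := fun f hf => by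
  refine ⟨@Measurable.of_discrete _ _ finiteSets.loc _ _ _, h ?_⟩
  rwa [abs_rpow_mem_ellSet_iff hp (one_div_pos.2 hp), one_div_mul_cancel hp.ne']

theorem abs_mem_L1_of_ellSet_one_subset_LPow (hp : 0 < p) (h : ellSet 1 ⊆ m.LPow (1 / p))
    {f : ℕ → ℝ} (hf : f ∈ ellSet p) : (fun n => |f n|) ∈ m.L1 := by
  have hpow : (fun n => |f n| ^ p) ∈ ellSet 1 := by
    rwa [abs_rpow_mem_ellSet_iff one_pos hp, mul_one]
  simpa only [Real.abs_rpow_of_nonneg (abs_nonneg _), abs_abs, one_div,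
    Real.rpow_rpow_inv (abs_nonneg _) hp.ne'] using (h hpow).2

theorem exists_hasUpperEstimate_of_ellSet_one_subset_LPow [Fact (1 ≤ ENNReal.ofReal p)]
    (h : ellSet 1 ⊆ m.LPow (1 / p)) :
    ∃ K, HasUpperEstimate ℝ (ENNReal.ofReal p) (fun n => m.toFun {n}) K := by
  have hp : 0 < p := zero_lt_one.trans_le (ENNReal.one_le_ofReal.1 Fact.out)
  refine exists_hasUpperEstimate_of_weakly_summable fun f x => ?_
  simpa only [Real.norm_eq_abs, abs_abs] using DeltaMeasure.summable_norm_mul_norm_of_mem_L1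
    (abs_mem_L1_of_ellSet_one_subset_LPow hp h (lp.memℓp f)) x

end Characterizations

theorem mainTheorem7_general {E : Type*} [NormedAddCommGroup E] [NormedSpace ℝ E] [CompleteSpace E]
    (m : DeltaMeasure finiteSets E) (p : ℝ) [Fact (1 ≤ ENNReal.ofReal p)] :
    List.TFAE [
      ∃ S : lp (fun _ : ℕ => ℝ) (ENNReal.ofReal p) →L[ℝ] E, ∀ n, S (lp.single _ n 1) = m.toFun {n},
      ellSet p ⊆ m.L1,
      ellSet 1 ⊆ m.LPow (1 / p) ∩ m.L1,
      ∃ C : ℝ, 0 < C ∧ ∀ (M : Finset ℕ) (x : ℕ → ℝ), (∀ j ∈ M, 0 ≤ x j) →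
        ‖∑ j ∈ M, x j • m.toFun {j}‖ ≤ C * (∑ j ∈ M, x j ^ p) ^ (1 / p)] := by
  have hp : 1 ≤ p := ENNReal.one_le_ofReal.1 Fact.out
  have hp0 : 0 < p := zero_lt_one.trans_le hp
  have hone : ellSet 1 ⊆ ellSet p := fun f hf => hf.of_exponent_ge (ENNReal.ofReal_le_ofReal hp)
  rw [← exists_hasUpperEstimate_ofReal_iff hp0]
  tfae_have 1 → 2 := fun ⟨S, hS⟩ => ellSet_subset_L1_of_continuousLinearMap S hS
  tfae_have 2 → 3 := fun h => Set.subset_inter (ellSet_one_subset_LPow hp0 h) (hone.trans h)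
  tfae_have 3 → 4 := fun h =>
    exists_hasUpperEstimate_of_ellSet_one_subset_LPow (h.trans Set.inter_subset_left)
  tfae_have 4 → 1 := fun ⟨_, hK⟩ => hK.exists_continuousLinearMap ENNReal.ofReal_ne_top
  tfae_finish

section AssociatedMeasure

variable {E : Type*} [NormedAddCommGroup E] [NormedSpace ℝ E]

theorem Ell1.e_eq_single (n : ℕ) : Ell1.e n = lp.single 1 n (1 : ℝ) := by
  ext k
  simp [Ell1.e, Ell1.chi, Pi.single_apply]

theorem assocMeasure_singleton (T : Ell1 →L[ℝ] E) (n : ℕ) :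
    (assocMeasure T).toFun {n} = T (Ell1.e n) :=
  dif_pos (Set.finite_singleton n)

theorem extendsToEll_iff {T : Ell1 →L[ℝ] E} {p : ℝ} {hp : 1 < p}
    [Fact (1 ≤ ENNReal.ofReal p)] :
    ExtendsToEll T p hp ↔ ∃ S : lp (fun _ : ℕ => ℝ) (ENNReal.ofReal p) →L[ℝ] E,
      ∀ n, S (lp.single _ n 1) = T (Ell1.e n) := by
  refine exists_congr fun S => ⟨fun hS n => ?_, fun hS x => ?_⟩
  · rw [← hS, Ell1.e_eq_single]
    rfl
  · refine (hasSum_smul_apply_single ENNReal.ofReal_ne_top S _).unique ?_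
    simp only [hS, Ell1.e_eq_single]
    exact hasSum_smul_apply_single ENNReal.one_ne_top T x

end AssociatedMeasure

theorem mainTheorem7 {E : Type*} [NormedAddCommGroup E] [NormedSpace ℝ E] [CompleteSpace E]
    (T : Ell1 →L[ℝ] E) (hT : ∀ n, T (Ell1.e n) ≠ 0) (p : ℝ) (hp : 1 < p) :
    List.TFAE [
      ExtendsToEll T p hp,
      ellSet p ⊆ (assocMeasure T).L1,
      ellSet 1 ⊆ (assocMeasure T).LPow (1 / p) ∩ (assocMeasure T).L1,
      ∃ C : ℝ, 0 < C ∧ ∀ (M : Finset ℕ) (x : ℕ → ℝ), (∀ j ∈ M, 0 ≤ x j) →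
        ‖∑ j ∈ M, x j • T (Ell1.e j)‖ ≤ C * (∑ j ∈ M, x j ^ p) ^ (1 / p)] := by
  have : Fact (1 ≤ ENNReal.ofReal p) := ⟨ENNReal.one_le_ofReal.2 hp.le⟩
  simpa only [extendsToEll_iff, assocMeasure_singleton] using
    mainTheorem7_general (assocMeasure T) p
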